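/- Let $p\in(1,2)$. Then there are constants $c_p,C_p>0$ depending only on $p$ such that the following holds. Let $n,m\in\mathbb N$, let $\xi_1,\dots,\xi_n$ be independent random variables on a probability space $(\Omega_1,\mathfrak A_1,\mathbb P_1)$, each with the $\log$-$\gamma_{1,2}$ distribution, where for $q,r>0$ the $\log$-$\gamma_{q,r}$ distribution is the one with density $\frac{r^q}{\Gamma(q)}x^{-r-1}(\ln x)^{q-1}$ for $x\ge 1$ and $0$ for $x<1$ (so here the density is $2x^{-3}$ on $[1,\infty)$). Let $\eta_1,\dots,\eta_m$ be independent identically distributed centred $p$-stable random variables on a probability space $(\Omega_2,\mathfrak A_2,\mathbb P_2)$, with scale $\sigma>0$ and skewness $\beta\in[-1,1]$, i.e. $$\mathbb E\, e^{it\eta_j}=\exp\Big(-\sigma^p|t|^p\big(1-i\beta\,\mathrm{sign}(t)\tan\tfrac{\pi p}{2}\big)\Big)\qquad(t\in\mathbb R);$$ in particular, for $\sigma=1$, $\beta=0$ the $\eta_j$ are standard symmetric $p$-stable, with characteristic function $e^{-|t|^p}$. Then for all real matrices $(a_{ij})_{1\le i\le n,\,1\le j\le m}$ the function $(\omega_1,\omega_2)\mapsto\max_{i,j}|a_{ij}\eta_j(\omega_2)\xi_i(\omega_1)|$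 is $\mathbb P_1\otimes\mathbb P_2$-integrable and $$c_p\,\sigma\,\Big(\sum_{j=1}^m\Big(\sum_{i=1}^n |a_{ij}|^2\Big)^{p/2}\Big)^{1/p}\;\le\;\mathbb E_{\Omega_1}\mathbb E_{\Omega_2}\max_{i,j}\big|a_{ij}\,\eta_j(\omega_2)\,\xi_i(\omega_1)\big|\;\le\; C_p\,\sigma\,\Big(\sum_{j=1}^m\Big(\sum_{i=1}^n |a_{ij}|^2\Big)^{p/2}\Big)^{1/p}.$$ -/

import Mathlib

open MeasureTheory ProbabilityTheory

noncomputable section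

/-- The density of the log-gamma distribution with parameters `q, p > 0`:
`p ^ q / Γ(q) * x ^ (-p - 1) * (ln x) ^ (q - 1)` for `x ≥ 1`, and `0` for `x < 1`. -/
def logGammaPDFReal (q p x : ℝ) : ℝ :=
  if 1 ≤ x then p ^ q / Real.Gamma q * x ^ (-p - 1) * (Real.log x) ^ (q - 1) else 0

/-- The log-gamma distribution with parameters `q, p > 0` on the real line. -/
def logGammaMeasure (q p : ℝ) : Measure ℝ :=
  volume.withDensity (fun x => ENNReal.ofReal (logGammaPDFReal q p x))

/-- `μ` is the centred `p`-stable law (`1 < p < 2`) with scale `σ > 0` and skewness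
`β ∈ [-1, 1]`: its characteristic function is
`t ↦ exp (-(σ |t|) ^ p * (1 - i * β * sign t * tan (π p / 2)))`.
For `β = 0` this is the symmetric `p`-stable law `exp (-(σ |t|) ^ p)`, and for `β = 0`, `σ = 1`
the standard one. -/
structure IsStableLaw (p σ β : ℝ) (μ : Measure ℝ) : Prop where
  isProbabilityMeasure : IsProbabilityMeasure μ
  scale_pos : 0 < σ
  skewness_mem : β ∈ Set.Icc (-1 : ℝ) 1
  charFun_eq : ∀ t : ℝ, charFun μ t =
    Complex.exp (-(((σ * |t|) ^ p : ℝ) : ℂ) *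
      (1 - ((β * Real.sign t * Real.tan (Real.pi * p / 2) : ℝ) : ℂ) * Complex.I))

/-- The `ℓ_p`-norm of a finite family of real numbers. -/
def vecLpNorm (p : ℝ) {ι : Type*} [Fintype ι] (x : ι → ℝ) : ℝ :=
  (∑ i, |x i| ^ p) ^ (1 / p)

end

/-! Weighted maxima of independent variables with tail of order `r ^ (-q)` have mean of order the
`ℓ_q`-norm of the weights. Here `ξ` has index `2` and `η` has index `p`, so freezing `ω₂` and
integrating over `Ω₁` first produces the mixed norm.

For the upper bound, the maximum over `j` is enlarged to an `ℓ₂`-norm of each row;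
`lintegral_iSup_mul_le` then yields twice the `ℓ₂`-norm of the column norms weighted by `η`. Since
`p < 2`, this square function is still controlled by the `ℓ_p`-norm
(`lintegral_vecLpNorm_two_le_of_tail_le`): apart from large jumps, truncated second moments suffice.
For the lower bound, `le_lintegral_iSup_mul` keeps only the best column, and
`le_lintegral_iSup_of_le_tail` treats the remaining maximum over `j`. Independence within each
family matters only for the lower bounds.

The two-sided tail of the stable law (`IsStableLaw.tail_le`, `IsStableLaw.le_tail`) is read off its
characteristic function near zero, uniformly in the skewness. -/

/-! ### Moments from tail bounds. -/

/-- A nonnegative random variable with tail `(D / s) ^ q`, `q > 1`, has mean at most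
`D * (q / (q - 1))`. -/
lemma lintegral_ofReal_le_of_tail_le {Ω : Type*} [MeasurableSpace Ω] {P : Measure Ω}
    [IsProbabilityMeasure P] {Z : Ω → ℝ} (hZ : AEMeasurable Z P) (hZ0 : ∀ ω, 0 ≤ Z ω)
    {q D : ℝ} (hq : 1 < q) (hD : 0 ≤ D)
    (htail : ∀ s : ℝ, 0 < s → P {ω | s < Z ω} ≤ ENNReal.ofReal ((D / s) ^ q)) :
    ∫⁻ ω, ENNReal.ofReal (Z ω) ∂P ≤ ENNReal.ofReal (D * (q / (q - 1))) := by
  rw [lintegral_eq_lintegral_meas_lt P (ae_of_all _ hZ0) hZ]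
  have hq0 : 0 < q - 1 := by linarith
  rcases hD.eq_or_lt with rfl | hD
  · rw [setLIntegral_congr_fun (g := fun _ => 0) measurableSet_Ioi]
    · simp
    · intro s hs
      have h := htail s hs
      rw [zero_div, Real.zero_rpow (by linarith), ENNReal.ofReal_zero] at h
      exact le_antisymm h bot_le
  -- Below `D` the tail bound exceeds `1`, so the trivial bound is used there.
  have hsplit : Set.Ioi (0 : ℝ) = Set.Ioc 0 D ∪ Set.Ioi D := (Set.Ioc_union_Ioi_eq_Ioi hD.le).symm
  rw [hsplit]
  refine (lintegral_union_le _ _ _).trans ?_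
  have h1 : ∫⁻ s in Set.Ioc 0 D, P {ω | s < Z ω} ≤ ENNReal.ofReal D := by
    calc ∫⁻ s in Set.Ioc 0 D, P {ω | s < Z ω} ≤ ∫⁻ _ in Set.Ioc 0 D, 1 :=
          lintegral_mono fun s => prob_le_one
      _ = ENNReal.ofReal D := by simp
  have h2 : ∫⁻ s in Set.Ioi D, P {ω | s < Z ω} ≤ ENNReal.ofReal (D / (q - 1)) := by
    have hint : IntegrableOn (fun s : ℝ => D ^ q * s ^ (-q)) (Set.Ioi D) :=
      (integrableOn_Ioi_rpow_of_lt (by linarith) hD).const_mul _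
    calc ∫⁻ s in Set.Ioi D, P {ω | s < Z ω}
        ≤ ∫⁻ s in Set.Ioi D, ENNReal.ofReal (D ^ q * s ^ (-q)) := by
          refine setLIntegral_mono' measurableSet_Ioi fun s hs => ?_
          have hs0 : 0 < s := hD.trans hs
          refine (htail s hs0).trans_eq ?_
          rw [Real.div_rpow hD.le hs0.le, Real.rpow_neg hs0.le, div_eq_mul_inv]
      _ = ENNReal.ofReal (∫ s in Set.Ioi D, D ^ q * s ^ (-q)) := by
          rw [ofReal_integral_eq_lintegral_ofReal hint]
          filter_upwards [ae_restrict_mem measurableSet_Ioi] with s hs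
          have hs0 : 0 < s := hD.trans hs
          positivity
      _ = ENNReal.ofReal (D / (q - 1)) := by
          rw [integral_const_mul, integral_Ioi_rpow_of_lt (by linarith) hD]
          congr 1
          rw [mul_div_assoc', mul_neg, ← Real.rpow_add hD, show q + (-q + 1) = 1 by ring,
            Real.rpow_one, show -q + 1 = -(q - 1) by ring, neg_div_neg_eq]
  refine (add_le_add h1 h2).trans_eq ?_
  rw [← ENNReal.ofReal_add hD.le (by positivity)]
  congr 1
  field_simp
  ring

/-- The truncated second moment of a random variable with tail `K * (σ / r) ^ p`, `p < 2`. -/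
lemma lintegral_min_sq_le_of_tail_le {μ : Measure ℝ} [IsProbabilityMeasure μ] {p K σ R : ℝ}
    (hp2 : p < 2) (hK : 0 ≤ K) (hσ : 0 < σ) (hR : 0 < R)
    (htail : ∀ r : ℝ, 0 < r → μ.real {x | r < |x|} ≤ K * (σ / r) ^ p) :
    ∫⁻ x, ENNReal.ofReal (min |x| R ^ 2) ∂μ
      ≤ ENNReal.ofReal (2 * K / (2 - p) * (σ / R) ^ p * R ^ 2) := by
  have hp0 : 0 < 2 - p := by linarith
  have h := lintegral_rpow_eq_lintegral_meas_lt_mul μ (f := fun x => min |x| R)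
    (ae_of_all _ fun x => le_min (abs_nonneg x) hR.le) (by fun_prop) (p := 2) two_pos
  simp only [Real.rpow_two] at h
  rw [h]
  have hint : IntegrableOn (fun t : ℝ => K * σ ^ p * t ^ (1 - p)) (Set.Ioc 0 R) := by
    have := intervalIntegral.intervalIntegrable_rpow' (a := 0) (b := R) (r := 1 - p)
      (by linarith)
    rw [intervalIntegrable_iff_integrableOn_Ioc_of_le hR.le] at this
    exact this.const_mul _
  have hle : ∫⁻ t in Set.Ioi 0, μ {x | t < min |x| R} * ENNReal.ofReal (t ^ ((2 : ℝ) - 1))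
      ≤ ∫⁻ t in Set.Ioc 0 R, ENNReal.ofReal (K * σ ^ p * t ^ (1 - p)) := by
    rw [← Set.Ioc_union_Ioi_eq_Ioi hR.le]
    refine (lintegral_union_le _ _ _).trans ?_
    have hzero : ∫⁻ t in Set.Ioi R, μ {x | t < min |x| R} * ENNReal.ofReal (t ^ ((2 : ℝ) - 1))
        = 0 := by
      rw [setLIntegral_congr_fun (g := fun _ => 0) measurableSet_Ioi]
      · simp
      · intro t ht
        have : {x : ℝ | t < min |x| R} = ∅ := by
          ext x
          simpa using fun _ => (Set.mem_Ioi.1 ht).le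
        simp only [this, measure_empty, zero_mul]
    rw [hzero, add_zero]
    refine setLIntegral_mono' measurableSet_Ioc fun t ht => ?_
    have ht0 : 0 < t := ht.1
    calc μ {x | t < min |x| R} * ENNReal.ofReal (t ^ ((2 : ℝ) - 1))
        ≤ ENNReal.ofReal (K * (σ / t) ^ p) * ENNReal.ofReal (t ^ ((2 : ℝ) - 1)) := by
          gcongr
          refine (measure_mono (t := {x | t < |x|}) fun x (hx : t < min |x| R) =>
            (lt_min_iff.1 hx).1).trans ?_
          rw [← ofReal_measureReal]
          exact ENNReal.ofReal_le_ofReal (htail t ht0)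
      _ = ENNReal.ofReal (K * σ ^ p * t ^ (1 - p)) := by
          rw [← ENNReal.ofReal_mul (by positivity)]
          congr 1
          rw [Real.div_rpow hσ.le ht0.le, show (1 : ℝ) - p = (2 - 1) - p by ring,
            Real.rpow_sub ht0 (2 - 1) p]
          ring
  refine (mul_le_mul_right hle _).trans_eq ?_
  rw [← ofReal_integral_eq_lintegral_ofReal hint, ← ENNReal.ofReal_mul zero_le_two]
  · congr 1
    rw [integral_const_mul, ← intervalIntegral.integral_of_le hR.le,
      integral_rpow (Or.inl (by linarith)), show 1 - p + 1 = 2 - p by ring,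
      Real.zero_rpow hp0.ne', Real.div_rpow hσ.le hR.le, Real.rpow_sub hR, Real.rpow_two]
    ring
  · filter_upwards [ae_restrict_mem measurableSet_Ioc] with t ht
    have ht0 : 0 < t := ht.1
    positivity

/-! ### Tails of stable laws. -/

lemma norm_one_sub_cexp_le {z : ℂ} (hz : z.re ≤ 0) : ‖1 - Complex.exp z‖ ≤ 2 * ‖z‖ := by
  rw [norm_sub_rev]
  rcases le_or_gt ‖z‖ 1 with h | h
  · exact Complex.norm_exp_sub_one_le h
  · have h1 : ‖Complex.exp z‖ ≤ 1 := by
      rw [Complex.norm_exp]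
      exact Real.exp_le_one_iff.2 hz
    calc ‖Complex.exp z - 1‖ ≤ ‖Complex.exp z‖ + ‖(1 : ℂ)‖ := norm_sub_le _ _
      _ ≤ 2 * ‖z‖ := by rw [norm_one]; linarith

lemma IsStableLaw.norm_one_sub_charFun_le {p σ β : ℝ} {μ : Measure ℝ}
    (h : IsStableLaw p σ β μ) (t : ℝ) :
    ‖1 - charFun μ t‖ ≤ 2 * ((σ * |t|) ^ p * (1 + |Real.tan (Real.pi * p / 2)|)) := by
  have hu : 0 ≤ (σ * |t|) ^ p := Real.rpow_nonneg (mul_nonneg h.scale_pos.le (abs_nonneg t)) p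
  have hβ : |β| ≤ 1 := abs_le.2 h.skewness_mem
  have hsign : |Real.sign t| ≤ 1 := by
    rcases Real.sign_apply_eq t with h | h | h <;> simp [h]
  rw [h.charFun_eq]
  refine (norm_one_sub_cexp_le ?_).trans ?_
  · rw [neg_mul, Complex.neg_re, Complex.re_ofReal_mul, Complex.sub_re, Complex.one_re,
      Complex.re_ofReal_mul, Complex.I_re, mul_zero, sub_zero, mul_one]
    exact neg_nonpos.2 hu
  · rw [norm_mul, norm_neg, Complex.norm_real, Real.norm_of_nonneg hu]
    gcongr
    refine (norm_sub_le _ _).trans ?_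
    rw [norm_one, norm_mul, Complex.norm_I, mul_one, Complex.norm_real, Real.norm_eq_abs,
      abs_mul, abs_mul]
    have : |β| * |Real.sign t| ≤ 1 := mul_le_one₀ hβ (abs_nonneg _) hsign
    nlinarith [abs_nonneg (Real.tan (Real.pi * p / 2))]

/-- The skewness only changes the phase of the characteristic function, not its modulus. -/
lemma IsStableLaw.re_charFun_le {p σ β : ℝ} {μ : Measure ℝ}
    (h : IsStableLaw p σ β μ) (t : ℝ) :
    (charFun μ t).re ≤ Real.exp (-(σ * |t|) ^ p) := by
  refine (Complex.re_le_norm _).trans_eq ?_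
  rw [h.charFun_eq, Complex.norm_exp]
  congr 1
  rw [neg_mul, Complex.neg_re, Complex.re_ofReal_mul, Complex.sub_re, Complex.one_re,
    Complex.re_ofReal_mul, Complex.I_re, mul_zero, sub_zero, mul_one]

/-- The constant in the upper tail bound of a `p`-stable law. -/
noncomputable def stableTailConst (p : ℝ) : ℝ := 4 * 2 ^ p * (1 + |Real.tan (Real.pi * p / 2)|)

lemma stableTailConst_pos (p : ℝ) : 0 < stableTailConst p := by
  unfold stableTailConst; positivity

/-- Mass beyond `r` is controlled by averaging `1 - charFun μ t` over frequencies `|t| ≤ 2 / r`,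
where it is `O((σ / r) ^ p)`. -/
lemma IsStableLaw.tail_le {p σ β : ℝ} {μ : Measure ℝ} (hp : 0 ≤ p)
    (h : IsStableLaw p σ β μ) {r : ℝ} (hr : 0 < r) :
    μ.real {x | r < |x|} ≤ stableTailConst p * (σ / r) ^ p := by
  have := h.isProbabilityMeasure
  have hσ := h.scale_pos
  refine (measureReal_abs_gt_le_integral_charFun hr).trans ?_
  have hb : ‖∫ t in (-2 * r⁻¹)..(2 * r⁻¹), 1 - charFun μ t‖
      ≤ 2 * ((σ * (2 * r⁻¹)) ^ p * (1 + |Real.tan (Real.pi * p / 2)|))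
        * |2 * r⁻¹ - -2 * r⁻¹| := by
    refine intervalIntegral.norm_integral_le_of_norm_le_const fun t ht => ?_
    refine (h.norm_one_sub_charFun_le t).trans ?_
    have hr' : 0 < r⁻¹ := inv_pos.2 hr
    rw [Set.uIoc_of_le (by linarith)] at ht
    have : |t| ≤ 2 * r⁻¹ := abs_le.2 ⟨by linarith [ht.1], ht.2⟩
    gcongr
  calc 2⁻¹ * r * ‖∫ t in (-2 * r⁻¹)..(2 * r⁻¹), 1 - charFun μ t‖
      ≤ 2⁻¹ * r * (2 * ((σ * (2 * r⁻¹)) ^ p * (1 + |Real.tan (Real.pi * p / 2)|))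
        * |2 * r⁻¹ - -2 * r⁻¹|) := by gcongr
    _ = stableTailConst p * (σ / r) ^ p := by
        have habs : |2 * r⁻¹ - -2 * r⁻¹| = 4 * r⁻¹ := by
          rw [show 2 * r⁻¹ - -2 * r⁻¹ = 4 * r⁻¹ by ring]
          exact abs_of_pos (by positivity)
        rw [habs, show σ * (2 * r⁻¹) = 2 * (σ / r) by ring, 
          Real.mul_rpow (by positivity) (by positivity),
          stableTailConst]
        field_simp

/-- The threshold, in units of the scale, from which on the lower tail bound holds. -/
noncomputable def stableThreshold (p : ℝ) : ℝ :=
  ((2 - p) / (4 * stableTailConst p)) ^ (1 / (2 - p))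

lemma stableThreshold_pos {p : ℝ} (hp2 : p < 2) : 0 < stableThreshold p :=
  Real.rpow_pos_of_pos (div_pos (by linarith) (by linarith [stableTailConst_pos p])) _

lemma Real.exp_neg_le_one_sub_half {u : ℝ} (h0 : 0 ≤ u) (h1 : u ≤ 1) :
    Real.exp (-u) ≤ 1 - u / 2 := by
  have h := Real.add_one_le_exp u
  rw [Real.exp_neg]
  refine inv_le_of_inv_le₀ (by linarith) (le_trans ?_ h)
  rw [inv_le_iff_one_le_mul₀ (by linarith)]
  nlinarith

/-- Integrate `1 - cos (t x)`, bounded by `2` for `|x| > R` and by `(t x) ^ 2 / 2` otherwise. This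
turns a lower bound on the left into a lower bound on the tail. -/
lemma one_sub_re_charFun_le_lintegral {μ : Measure ℝ} [IsProbabilityMeasure μ] (t R : ℝ) :
    ENNReal.ofReal (1 - (charFun μ t).re) ≤
      2 * μ {x | R < |x|} + ENNReal.ofReal (t ^ 2 / 2) *
        ∫⁻ x, ENNReal.ofReal (min |x| R ^ 2) ∂μ := by
  have hint : Integrable (fun x : ℝ => Complex.exp (t * x * Complex.I)) μ := by
    refine (integrable_const (1 : ℝ)).mono' (by fun_prop) (ae_of_all _ fun x => ?_)
    rw [← Complex.ofReal_mul, Complex.norm_exp_ofReal_mul_I]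
  have hre : ∀ x : ℝ, (Complex.exp (t * x * Complex.I)).re = Real.cos (t * x) := fun x => by
    rw [← Complex.ofReal_mul, Complex.exp_ofReal_mul_I_re]
  have hcos : Integrable (fun x : ℝ => Real.cos (t * x)) μ := by
    simpa only [hre, Complex.reCLM_apply, RCLike.re_eq_complex_re] using hint.re
  have heq : 1 - (charFun μ t).re = ∫ x, (1 - Real.cos (t * x)) ∂μ := by
    rw [integral_sub (integrable_const _) hcos, charFun_apply_real]
    have := integral_re hint
    simp only [RCLike.re_eq_complex_re, hre] at this
    rw [← this]
    simp
  rw [heq, ofReal_integral_eq_lintegral_ofReal (f := fun x => 1 - Real.cos (t * x))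
    ((integrable_const _).sub hcos) (ae_of_all _ fun x => sub_nonneg.2 (Real.cos_le_one (t * x)))]
  have hm : MeasurableSet {x : ℝ | R < |x|} := measurableSet_lt measurable_const (by fun_prop)
  calc ∫⁻ x, ENNReal.ofReal (1 - Real.cos (t * x)) ∂μ
      ≤ ∫⁻ x, ({x : ℝ | R < |x|}.indicator (fun _ => 2) x
          + ENNReal.ofReal (t ^ 2 / 2) * ENNReal.ofReal (min |x| R ^ 2)) ∂μ := by
        refine lintegral_mono fun x => ?_
        by_cases hx : R < |x|
        · rw [Set.indicator_of_mem (by exact hx)]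
          refine le_add_right ?_
          calc ENNReal.ofReal (1 - Real.cos (t * x)) ≤ ENNReal.ofReal 2 :=
                ENNReal.ofReal_le_ofReal (by linarith [Real.neg_one_le_cos (t * x)])
            _ = 2 := by simp
        · rw [Set.indicator_of_notMem (by exact hx), zero_add,
            ← ENNReal.ofReal_mul (by positivity), min_eq_left (not_lt.1 hx), sq_abs]
          refine ENNReal.ofReal_le_ofReal ?_
          have := Real.one_sub_sq_div_two_le_cos (x := t * x)
          rw [mul_pow] at this
          linarith
    _ = _ := by
        rw [lintegral_add_left (measurable_const.indicator hm), lintegral_indicator_const hm,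
          lintegral_const_mul _ (by fun_prop)]

/-- At frequency `δ / r`, `1 - Re charFun` is at least `δ ^ p * (σ / r) ^ p / 2`; for small `δ` the
truncated second moment, of order `δ ^ 2` with `p < 2`, cannot account for all of it, so the tail
must. -/
lemma IsStableLaw.le_tail {p σ β : ℝ} {μ : Measure ℝ} (hp : 0 ≤ p) (hp2 : p < 2)
    (h : IsStableLaw p σ β μ) {r : ℝ} (hr : stableThreshold p * σ ≤ r) :
    stableThreshold p ^ p / 8 * (σ / r) ^ p ≤ μ.real {x | r < |x|} := by
  have := h.isProbabilityMeasure
  have hσ := h.scale_pos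
  have hp0 : 0 < 2 - p := by linarith
  have hK := stableTailConst_pos p
  set K := stableTailConst p with hKdef
  have hδ := stableThreshold_pos hp2
  set δ := stableThreshold p with hδdef
  have hr0 : 0 < r := lt_of_lt_of_le (by positivity) hr
  -- `stableThreshold` is chosen so that the second-moment term is exactly half of the lower bound
  -- `hlow`.
  have hδK : K / (2 - p) * δ ^ 2 = δ ^ p / 4 := by
    have h1 : δ ^ (2 - p) = (2 - p) / (4 * K) := by
      rw [hδdef, stableThreshold, ← Real.rpow_mul (by positivity), one_div,
        inv_mul_cancel₀ hp0.ne', Real.rpow_one]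
    have h2 : δ ^ 2 = δ ^ p * δ ^ (2 - p) := by
      rw [← Real.rpow_add hδ, ← Real.rpow_two]; congr 1; ring
    rw [h2, h1]
    field_simp
  have hu : (σ * |δ / r|) ^ p = δ ^ p * (σ / r) ^ p := by
    rw [abs_of_pos (by positivity), ← Real.mul_rpow (by positivity) (by positivity)]
    congr 1; ring
  have hu1 : δ ^ p * (σ / r) ^ p ≤ 1 := by
    rw [← Real.mul_rpow (by positivity) (by positivity)]
    refine Real.rpow_le_one (by positivity) ?_ hp
    rw [mul_div_assoc', div_le_one hr0]
    exact hr
  have hlow : δ ^ p * (σ / r) ^ p / 2 ≤ 1 - (charFun μ (δ / r)).re := by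
    have h1 := h.re_charFun_le (δ / r)
    rw [hu] at h1
    linarith [Real.exp_neg_le_one_sub_half (by positivity) hu1]
  have hmain := one_sub_re_charFun_le_lintegral (μ := μ) (δ / r) r
  have htr := lintegral_min_sq_le_of_tail_le hp2 hK.le hσ hr0 (fun r hr => h.tail_le hp hr)
  have hfin : ENNReal.ofReal (1 - (charFun μ (δ / r)).re) ≤
      ENNReal.ofReal (2 * μ.real {x | r < |x|} + δ ^ p * (σ / r) ^ p / 4) := by
    refine hmain.trans ((add_le_add_right (mul_le_mul_right htr _) _).trans_eq ?_)
    rw [← ENNReal.ofReal_mul (by positivity), ENNReal.ofReal_add (by positivity) (by positivity),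
      ENNReal.ofReal_mul zero_le_two, ofReal_measureReal]
    congr 2
    · simp
    · calc _ = K / (2 - p) * δ ^ 2 * (σ / r) ^ p := by field_simp
        _ = _ := by rw [hδK]; ring
  rw [ENNReal.ofReal_le_ofReal_iff (by positivity)] at hfin
  linarith

/-! ### Finite `ℓ_q`-norms. -/

section vecLpNorm
variable {ι : Type*} [Fintype ι] {q : ℝ}

lemma vecLpNorm_nonneg (x : ι → ℝ) : 0 ≤ vecLpNorm q x :=
  Real.rpow_nonneg (Finset.sum_nonneg fun i _ => Real.rpow_nonneg (abs_nonneg (x i)) q) _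

lemma vecLpNorm_rpow (hq : 0 < q) (x : ι → ℝ) : vecLpNorm q x ^ q = ∑ i, |x i| ^ q := by
  rw [vecLpNorm, ← Real.rpow_mul
    (Finset.sum_nonneg fun i _ => Real.rpow_nonneg (abs_nonneg (x i)) q), one_div,
    inv_mul_cancel₀ hq.ne', Real.rpow_one]

lemma abs_le_vecLpNorm (hq : 0 < q) (x : ι → ℝ) (i : ι) : |x i| ≤ vecLpNorm q x := by
  rw [← Real.rpow_le_rpow_iff (abs_nonneg _) (vecLpNorm_nonneg x) hq, vecLpNorm_rpow hq]
  exact Finset.single_le_sum (f := fun i => |x i| ^ q)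
    (fun i _ => Real.rpow_nonneg (abs_nonneg (x i)) q) (Finset.mem_univ i)

lemma vecLpNorm_mul_right (hq : 0 < q) (x : ι → ℝ) (c : ℝ) :
    vecLpNorm q (fun i => |x i| * |c|) = vecLpNorm q x * |c| := by
  rw [← Real.rpow_left_inj (vecLpNorm_nonneg _)
    (mul_nonneg (vecLpNorm_nonneg x) (abs_nonneg c)) hq.ne', vecLpNorm_rpow hq,
    Real.mul_rpow (vecLpNorm_nonneg x) (abs_nonneg c), vecLpNorm_rpow hq, Finset.sum_mul]
  refine Finset.sum_congr rfl fun i _ => ?_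
  rw [abs_mul, abs_abs, abs_abs, Real.mul_rpow (abs_nonneg _) (abs_nonneg _)]

lemma sum_rpow_weights (hq : 0 < q) {σ s : ℝ} (hσ : 0 ≤ σ) {b : ι → ℝ} (hb : ∀ j, 0 ≤ b j)
    (hs : 0 < s) : ∑ j, (σ * b j / s) ^ q = (σ * vecLpNorm q b / s) ^ q := by
  rw [Real.div_rpow (mul_nonneg hσ (vecLpNorm_nonneg b)) hs.le,
    Real.mul_rpow hσ (vecLpNorm_nonneg b), vecLpNorm_rpow hq, Finset.mul_sum, Finset.sum_div]
  refine Finset.sum_congr rfl fun j _ => ?_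
  rw [Real.div_rpow (mul_nonneg hσ (hb j)) hs.le, Real.mul_rpow hσ (hb j), abs_of_nonneg (hb j)]

/-- The `ℓ₂`-norm of the row norms of a matrix with rescaled columns. -/
lemma vecLpNorm_two_rows_eq_columns {κ : Type*} [Fintype κ] (a : ι → κ → ℝ) (y : κ → ℝ) :
    vecLpNorm 2 (fun i => vecLpNorm 2 fun j => a i j * y j)
      = vecLpNorm 2 (fun j => vecLpNorm 2 (fun i => a i j) * y j) := by
  rw [← Real.rpow_left_inj (vecLpNorm_nonneg _) (vecLpNorm_nonneg _) two_ne_zero,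
    vecLpNorm_rpow two_pos, vecLpNorm_rpow two_pos]
  simp only [abs_mul, abs_of_nonneg (vecLpNorm_nonneg _),
    Real.mul_rpow (vecLpNorm_nonneg _) (abs_nonneg _), vecLpNorm_rpow two_pos,
    Real.mul_rpow (abs_nonneg _) (abs_nonneg _), Finset.sum_mul]
  exact Finset.sum_comm

end vecLpNorm

/-- The tail of the `log`-`γ_{1,2}` law. -/
lemma logGammaMeasure_one_two_tail {r : ℝ} (hr : 1 ≤ r) :
    (logGammaMeasure 1 2).real {x | r < |x|} = (1 / r) ^ (2 : ℝ) := by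
  have hr0 : 0 < r := by linarith
  have hm : MeasurableSet {x : ℝ | r < |x|} := measurableSet_lt measurable_const (by fun_prop)
  have hint : IntegrableOn (fun x : ℝ => 2 * x ^ (-3 : ℝ)) (Set.Ioi r) :=
    (integrableOn_Ioi_rpow_of_lt (by norm_num) hr0).const_mul _
  have key : logGammaMeasure 1 2 {x | r < |x|} = ENNReal.ofReal ((1 / r) ^ (2 : ℝ)) := by
    rw [logGammaMeasure, withDensity_apply _ hm]
    calc ∫⁻ x in {x : ℝ | r < |x|}, ENNReal.ofReal (logGammaPDFReal 1 2 x)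
        = ∫⁻ x in Set.Ioi r, ENNReal.ofReal (2 * x ^ (-3 : ℝ)) := by
          rw [← lintegral_indicator hm, ← lintegral_indicator measurableSet_Ioi]
          refine lintegral_congr fun x => ?_
          by_cases hx : r < x
          · rw [Set.indicator_of_mem (show x ∈ {x : ℝ | r < |x|} from hx.trans_le (le_abs_self x)),
              Set.indicator_of_mem (show x ∈ Set.Ioi r from hx), logGammaPDFReal,
              if_pos (hr.trans hx.le)]
            norm_num
          · rw [Set.indicator_of_notMem (show x ∉ Set.Ioi r from hx)]
            by_cases hx' : r < |x|
            · rw [Set.indicator_of_mem (by exact hx'), logGammaPDFReal, if_neg,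
                ENNReal.ofReal_zero]
              intro h1
              rw [abs_of_nonneg (by linarith)] at hx'
              exact hx hx'
            · rw [Set.indicator_of_notMem (by exact hx')]
      _ = ENNReal.ofReal (∫ x in Set.Ioi r, 2 * x ^ (-3 : ℝ)) := by
          rw [ofReal_integral_eq_lintegral_ofReal hint]
          filter_upwards [ae_restrict_mem measurableSet_Ioi] with x hx
          have hx0 : 0 < x := hr0.trans hx
          positivity
      _ = ENNReal.ofReal ((1 / r) ^ (2 : ℝ)) := by
          rw [integral_const_mul, integral_Ioi_rpow_of_lt (by norm_num) hr0, one_div,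
            Real.inv_rpow hr0.le, ← Real.rpow_neg hr0.le]
          congr 1
          rw [show (-3 : ℝ) + 1 = -2 by norm_num]
          ring
  rw [Measure.real, key, ENNReal.toReal_ofReal (by positivity)]

/-! ### Maxima and square functions of heavy-tailed variables. -/

section maxima
variable {Ω ι : Type*} [MeasurableSpace Ω] {P : Measure Ω}
  [Fintype ι] {X : ι → Ω → ℝ} {ν : Measure ℝ}

lemma HasLaw.measure_abs_gt {Y : Ω → ℝ} (hY : HasLaw Y ν P) [IsFiniteMeasure ν] (r : ℝ) :
    P {ω | r < |Y ω|} = ENNReal.ofReal (ν.real {x | r < |x|}) := by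
  rw [ofReal_measureReal, ← hY.measure_eq (p := fun x => r < |x|)]
  exact measurableSet_lt measurable_const (by fun_prop)

lemma aemeasurable_iSup_mul_abs (hX : ∀ j, HasLaw (X j) ν P) (b : ι → ℝ) :
    AEMeasurable (fun ω => ⨆ j, b j * |X j ω|) P :=
  AEMeasurable.iSup fun j =>
    ((measurable_norm.comp_aemeasurable (hX j).aemeasurable).const_mul (b j))

variable [IsProbabilityMeasure P]

/-- Lower bound for the expected maximum of independent variables with a common heavy-tailed
law. -/
lemma le_lintegral_iSup_of_le_tail (hX : ∀ j, HasLaw (X j) ν P) (hind : iIndepFun X P)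
    {q κ τ σ : ℝ} (hq : 0 < q) (hτ : 0 < τ) (hσ : 0 < σ)
    (htail : ∀ r : ℝ, τ * σ ≤ r → κ * (σ / r) ^ q ≤ ν.real {x | r < |x|})
    (b : ι → ℝ) (hb : ∀ j, 0 ≤ b j) :
    ENNReal.ofReal (τ * (1 - Real.exp (-(κ / τ ^ q))) * σ * vecLpNorm q b)
      ≤ ∫⁻ ω, ENNReal.ofReal (⨆ j, b j * |X j ω|) ∂P := by
  set B := vecLpNorm q b with hB
  rcases (vecLpNorm_nonneg b : 0 ≤ B).eq_or_lt with hB0 | hB0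
  · rw [show B = 0 from hB0.symm, mul_zero, ENNReal.ofReal_zero]
    exact zero_le
  -- Since `b j ≤ B`, each level `s / b j` is at least `τ * σ`, where the tail bound applies. By `1
  -- - x ≤ exp (-x)` and independence, the maximum stays below `s` with probability at most `exp
  -- (-(κ / τ ^ q))`.
  set s := τ * σ * B with hs
  have hs0 : 0 < s := by positivity
  have hbound : ∀ j, (P (X j ⁻¹' {x | b j * |x| ≤ s})) ≤
      ENNReal.ofReal (Real.exp (-(κ * (b j / (τ * B)) ^ q))) := by
    intro j
    have hmeas : MeasurableSet {x : ℝ | b j * |x| ≤ s} :=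
      measurableSet_le (by fun_prop) measurable_const
    have : IsProbabilityMeasure ν := by
      rw [← (hX j).map_eq]; exact Measure.isProbabilityMeasure_map (hX j).aemeasurable
    have h1 : P (X j ⁻¹' {x | b j * |x| ≤ s}) = ν {x | b j * |x| ≤ s} :=
      (hX j).measure_eq (p := fun x => b j * |x| ≤ s) hmeas
    rw [h1, ← ofReal_measureReal]
    refine ENNReal.ofReal_le_ofReal ?_
    rcases (hb j).eq_or_lt with hj | hj
    · rw [← hj, zero_div, Real.zero_rpow hq.ne', mul_zero, neg_zero, Real.exp_zero]
      exact measureReal_le_one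
    · have hcompl : {x : ℝ | b j * |x| ≤ s} = {x | s / b j < |x|}ᶜ := by
        ext x
        simp [le_div_iff₀ hj, mul_comm]
      have hbB : b j ≤ B := (le_abs_self _).trans (abs_le_vecLpNorm hq b j)
      have ht := htail (s / b j) (by
        rw [le_div_iff₀ hj, hs]
        gcongr)
      rw [show σ / (s / b j) = b j / (τ * B) by rw [hs]; field_simp] at ht
      rw [hcompl, probReal_compl_eq_one_sub (measurableSet_lt measurable_const (by fun_prop))]
      have := Real.add_one_le_exp (-(κ * (b j / (τ * B)) ^ q))
      linarith
  have hE : P (⋂ j, X j ⁻¹' {x | b j * |x| ≤ s}) ≤ ENNReal.ofReal (Real.exp (-(κ / τ ^ q))) := by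
    rw [hind.meas_iInter fun j => ⟨_, measurableSet_le (by fun_prop) measurable_const, rfl⟩]
    refine (Finset.prod_le_prod' fun j _ => hbound j).trans_eq ?_
    rw [← ENNReal.ofReal_prod_of_nonneg fun j _ => (Real.exp_pos _).le, ← Real.exp_sum,
      Finset.sum_neg_distrib, ← Finset.mul_sum]
    congr 3
    have hsum : ∑ j, (b j / (τ * B)) ^ q = (∑ j, |b j| ^ q) / (τ * B) ^ q := by
      rw [Finset.sum_div]
      refine Finset.sum_congr rfl fun j _ => ?_
      rw [Real.div_rpow (hb j) (by positivity), abs_of_nonneg (hb j)]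
    rw [hsum, ← vecLpNorm_rpow hq b, ← hB, Real.mul_rpow hτ.le hB0.le]
    have : B ^ q ≠ 0 := (Real.rpow_pos_of_pos hB0 q).ne'
    rw [← hB]
    field_simp
  have hcov : (1 : ENNReal) ≤ P (⋂ j, X j ⁻¹' {x | b j * |x| ≤ s})
      + P {ω | ENNReal.ofReal s ≤ ENNReal.ofReal (⨆ j, b j * |X j ω|)} := by
    rw [← measure_univ (μ := P)]
    refine (measure_mono fun ω _ => ?_).trans (measure_union_le _ _)
    by_cases hω : ∀ j, b j * |X j ω| ≤ s
    · exact Or.inl (Set.mem_iInter.2 hω)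
    · push Not at hω
      obtain ⟨j, hj⟩ := hω
      exact Or.inr (ENNReal.ofReal_le_ofReal
        (hj.le.trans (le_ciSup (f := fun j => b j * |X j ω|) (Set.finite_range _).bddAbove j)))
  have hP : ENNReal.ofReal (1 - Real.exp (-(κ / τ ^ q)))
      ≤ P {ω | ENNReal.ofReal s ≤ ENNReal.ofReal (⨆ j, b j * |X j ω|)} := by
    rw [ENNReal.ofReal_sub _ (Real.exp_pos _).le, ENNReal.ofReal_one, tsub_le_iff_left]
    exact hcov.trans (add_le_add_left hE _)
  calc ENNReal.ofReal (τ * (1 - Real.exp (-(κ / τ ^ q))) * σ * B)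
      = ENNReal.ofReal s * ENNReal.ofReal (1 - Real.exp (-(κ / τ ^ q))) := by
        rw [← ENNReal.ofReal_mul hs0.le]
        congr 1
        rw [hs]; ring
    _ ≤ ENNReal.ofReal s * P {ω | ENNReal.ofReal s ≤ ENNReal.ofReal (⨆ j, b j * |X j ω|)} := by
        gcongr
    _ ≤ _ := mul_meas_ge_le_lintegral₀ (aemeasurable_iSup_mul_abs hX b).ennreal_ofReal _

lemma measure_lt_mul_abs_le {Y : Ω → ℝ} (hY : HasLaw Y ν P) {q K σ : ℝ}
    (htail : ∀ r : ℝ, 0 < r → ν.real {x | r < |x|} ≤ K * (σ / r) ^ q)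
    {b s : ℝ} (hb : 0 ≤ b) (hs : 0 < s) :
    P {ω | s < b * |Y ω|} ≤ ENNReal.ofReal (K * (σ * b / s) ^ q) := by
  have : IsProbabilityMeasure ν := by
    rw [← hY.map_eq]; exact Measure.isProbabilityMeasure_map hY.aemeasurable
  rcases hb.eq_or_lt with rfl | hb
  · simp [hs.not_gt]
  · have hset : {ω | s < b * |Y ω|} = {ω | s / b < |Y ω|} := by
      ext ω
      simp [div_lt_iff₀ hb, mul_comm]
    rw [hset, HasLaw.measure_abs_gt hY]
    refine ENNReal.ofReal_le_ofReal ((htail _ (by positivity)).trans_eq ?_)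
    rw [div_div_eq_mul_div]

/-- Union bound for a weighted family of variables with power-law tails. -/
lemma sum_measure_lt_mul_abs_le (hX : ∀ j, HasLaw (X j) ν P) {q K σ : ℝ} (hq : 0 < q)
    (hK : 0 ≤ K) (hσ : 0 ≤ σ)
    (htail : ∀ r : ℝ, 0 < r → ν.real {x | r < |x|} ≤ K * (σ / r) ^ q)
    {b : ι → ℝ} (hb : ∀ j, 0 ≤ b j) {s : ℝ} (hs : 0 < s) :
    P (⋃ j, {ω | s < b j * |X j ω|}) ≤ ENNReal.ofReal (K * (σ * vecLpNorm q b / s) ^ q) := by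
  refine (measure_iUnion_fintype_le _ _).trans ?_
  refine (Finset.sum_le_sum fun j _ => measure_lt_mul_abs_le (hX j) htail (hb j) hs).trans_eq ?_
  rw [← ENNReal.ofReal_sum_of_nonneg fun j _ => mul_nonneg hK
    (Real.rpow_nonneg (div_nonneg (mul_nonneg hσ (hb j)) hs.le) q), ← Finset.mul_sum,
    sum_rpow_weights hq hσ hb hs]

/-- Upper bound for the expected maximum of variables with a common law of tail `r ^ (-q)`. -/
lemma lintegral_iSup_le_of_tail_le (hX : ∀ j, HasLaw (X j) ν P) {q : ℝ} (hq : 1 < q)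
    (htail : ∀ r : ℝ, 0 < r → ν.real {x | r < |x|} ≤ (1 / r) ^ q)
    (b : ι → ℝ) (hb : ∀ j, 0 ≤ b j) :
    ∫⁻ ω, ENNReal.ofReal (⨆ j, b j * |X j ω|) ∂P
      ≤ ENNReal.ofReal (vecLpNorm q b * (q / (q - 1))) := by
  refine lintegral_ofReal_le_of_tail_le (aemeasurable_iSup_mul_abs hX b)
    (fun ω => Real.iSup_nonneg fun j => mul_nonneg (hb j) (abs_nonneg _)) hq
    (vecLpNorm_nonneg b) fun s hs => ?_
  have h := sum_measure_lt_mul_abs_le hX (q := q) (K := 1) (σ := 1) (by linarith) zero_le_one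
    zero_le_one (by simpa using htail) hb hs
  rw [one_mul, one_mul] at h
  refine (measure_mono fun ω hω => ?_).trans h
  by_contra hcon
  simp only [Set.mem_iUnion, Set.mem_ofPred_eq, not_exists, not_lt] at hcon
  exact absurd (Real.iSup_le hcon hs.le) (not_le.2 hω)

lemma lintegral_min_mul_abs_sq_le {Y : Ω → ℝ} (hY : HasLaw Y ν P) {p K σ : ℝ}
    (hp2 : p < 2) (hK : 0 ≤ K) (hσ : 0 < σ)
    (htail : ∀ r : ℝ, 0 < r → ν.real {x | r < |x|} ≤ K * (σ / r) ^ p)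
    {b s : ℝ} (hb : 0 ≤ b) (hs : 0 < s) :
    ∫⁻ ω, ENNReal.ofReal (min (b * |Y ω|) s ^ 2) ∂P
      ≤ ENNReal.ofReal (2 * K / (2 - p) * (σ * b / s) ^ p * s ^ 2) := by
  have : IsProbabilityMeasure ν := by
    rw [← hY.map_eq]; exact Measure.isProbabilityMeasure_map hY.aemeasurable
  rcases hb.eq_or_lt with rfl | hb
  · simp [hs.le]
  · have hmin : ∀ y : ℝ, min (b * |y|) s ^ 2 = b ^ 2 * min |y| (s / b) ^ 2 := fun y => by
      rw [← mul_pow, mul_min_of_nonneg _ _ hb.le, mul_div_cancel₀ _ hb.ne']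
    simp only [hmin, ENNReal.ofReal_mul (sq_nonneg b)]
    rw [hY.lintegral_comp (f := fun y => ENNReal.ofReal (b ^ 2) *
      ENNReal.ofReal (min |y| (s / b) ^ 2)) (by fun_prop), lintegral_const_mul _ (by fun_prop)]
    refine (mul_le_mul_right
      (lintegral_min_sq_le_of_tail_le hp2 hK hσ (div_pos hs hb) htail) _).trans_eq ?_
    rw [← ENNReal.ofReal_mul (sq_nonneg b), div_div_eq_mul_div]
    congr 1
    field_simp

/-- The weak-type constant for square functions of variables with tail `K * r ^ (-p)`. -/
noncomputable def squareFunctionConst (p K : ℝ) : ℝ := (K * (1 + 2 / (2 - p))) ^ (1 / p)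

/-- Upper bound for the expected `ℓ₂`-norm of variables with power-law tails of index `p < 2`. -/
lemma lintegral_vecLpNorm_two_le_of_tail_le (hX : ∀ j, HasLaw (X j) ν P) {p K σ : ℝ}
    (hp1 : 1 < p) (hp2 : p < 2) (hK : 0 ≤ K) (hσ : 0 < σ)
    (htail : ∀ r : ℝ, 0 < r → ν.real {x | r < |x|} ≤ K * (σ / r) ^ p)
    (b : ι → ℝ) (hb : ∀ j, 0 ≤ b j) :
    ∫⁻ ω, ENNReal.ofReal (vecLpNorm 2 fun j => b j * X j ω) ∂P
      ≤ ENNReal.ofReal (squareFunctionConst p K * σ * vecLpNorm p b * (p / (p - 1))) := by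
  have hp0 : 0 < p := by linarith
  have hp2' : 0 < 2 - p := by linarith
  have hB := vecLpNorm_nonneg (q := p) b
  have hXm := fun j => (hX j).aemeasurable
  have hc : 0 ≤ squareFunctionConst p K := by unfold squareFunctionConst; positivity
  have hmeas : AEMeasurable (fun ω => vecLpNorm 2 fun j => b j * X j ω) P := by
    unfold vecLpNorm
    refine AEMeasurable.pow_const (Finset.aemeasurable_fun_sum _ fun j _ => ?_) _
    exact (measurable_norm.comp_aemeasurable ((hXm j).const_mul (b j))).pow_const _
  refine lintegral_ofReal_le_of_tail_le hmeas (fun ω => vecLpNorm_nonneg _) hp1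
    (by positivity) fun s hs => ?_
  have h1 := sum_measure_lt_mul_abs_le hX hp0 hK hσ.le htail hb hs
  have hminm : ∀ j, AEMeasurable (fun ω => ENNReal.ofReal (min (b j * |X j ω|) s ^ 2)) P :=
    fun j => (((measurable_norm.comp_aemeasurable (hXm j)).const_mul (b j)).min
      aemeasurable_const).pow_const 2 |>.ennreal_ofReal
  have h2 : P {ω | ENNReal.ofReal (s ^ 2) ≤ ∑ j, ENNReal.ofReal (min (b j * |X j ω|) s ^ 2)}
      ≤ ENNReal.ofReal (2 * K / (2 - p) * (σ * vecLpNorm p b / s) ^ p) := by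
    refine (meas_ge_le_lintegral_div (Finset.aemeasurable_fun_sum _ fun j _ => hminm j)
      (by simpa using hs.ne') ENNReal.ofReal_ne_top).trans ?_
    rw [ENNReal.div_le_iff (by simpa using hs.ne') ENNReal.ofReal_ne_top,
      lintegral_finsetSum' _ fun j _ => hminm j]
    refine (Finset.sum_le_sum fun j _ =>
      lintegral_min_mul_abs_sq_le (hX j) hp2 hK hσ htail (hb j) hs).trans_eq ?_
    rw [← ENNReal.ofReal_mul (by positivity), ← ENNReal.ofReal_sum_of_nonneg fun j _ => by
      have := hb j
      positivity, ← Finset.sum_mul, ← Finset.mul_sum, sum_rpow_weights hp0 hσ.le hb hs]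
  -- If no single term exceeds `s`, truncation at `s` changes nothing, and a large norm forces a
  -- large sum of truncated squares.
  have hcov : {ω | s < vecLpNorm 2 fun j => b j * X j ω} ⊆ (⋃ j, {ω | s < b j * |X j ω|}) ∪
      {ω | ENNReal.ofReal (s ^ 2) ≤ ∑ j, ENNReal.ofReal (min (b j * |X j ω|) s ^ 2)} := by
    intro ω hω
    rw [Set.mem_union, or_iff_not_imp_left]
    intro hcon
    simp only [Set.mem_iUnion, Set.mem_ofPred_eq, not_exists, not_lt] at hcon hω ⊢
    rw [← ENNReal.ofReal_sum_of_nonneg fun j _ => sq_nonneg _]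
    refine ENNReal.ofReal_le_ofReal ?_
    have h := Real.rpow_le_rpow hs.le hω.le zero_le_two
    rw [vecLpNorm_rpow two_pos, Real.rpow_two] at h
    refine h.trans_eq (Finset.sum_congr rfl fun j _ => ?_)
    rw [min_eq_left (hcon j), Real.rpow_two, abs_mul, abs_of_nonneg (hb j)]
  refine (measure_mono hcov).trans ((measure_union_le _ _).trans ((add_le_add h1 h2).trans_eq ?_))
  rw [← ENNReal.ofReal_add (by positivity) (by positivity)]
  congr 1
  rw [mul_assoc (squareFunctionConst p K), mul_div_assoc (squareFunctionConst p K),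
    Real.mul_rpow hc (by positivity), squareFunctionConst,
    ← Real.rpow_mul (by positivity), one_div, inv_mul_cancel₀ hp0.ne', Real.rpow_one]
  ring

end maxima

/-! ### Integration over `Ω₁` for frozen `η`. -/

section mixed
variable {Ω₁ Ω₂ ι κ : Type*} [MeasurableSpace Ω₁] [MeasurableSpace Ω₂]
  {P₁ : Measure Ω₁} {P₂ : Measure Ω₂}
  [Fintype ι] [Fintype κ] {ξ : ι → Ω₁ → ℝ} {η : κ → Ω₂ → ℝ}

lemma aemeasurable_iSup_prod {ν μ : Measure ℝ} (hξ : ∀ i, HasLaw (ξ i) ν P₁)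
    (hη : ∀ j, HasLaw (η j) μ P₂) (a : ι → κ → ℝ) :
    AEMeasurable (fun ω : Ω₁ × Ω₂ => ⨆ k : ι × κ, |a k.1 k.2 * η k.2 ω.2 * ξ k.1 ω.1|)
      (P₁.prod P₂) :=
  AEMeasurable.iSup fun k => measurable_norm.comp_aemeasurable
    (((hη k.2).aemeasurable.comp_snd.const_mul (a k.1 k.2)).mul (hξ k.1).aemeasurable.comp_fst)

variable [IsProbabilityMeasure P₁]

/-- The expected maximum over `Ω₁` is at most twice an `ℓ₂`-norm. -/
lemma lintegral_iSup_mul_le (hξ : ∀ i, HasLaw (ξ i) (logGammaMeasure 1 2) P₁)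
    (a : ι → κ → ℝ) (y : κ → ℝ) :
    ∫⁻ ω, ENNReal.ofReal (⨆ k : ι × κ, |a k.1 k.2 * y k.2 * ξ k.1 ω|) ∂P₁
      ≤ 2 * ENNReal.ofReal (vecLpNorm 2 fun j => vecLpNorm 2 (fun i => a i j) * y j) := by
  rcases isEmpty_or_nonempty ι with hι | ⟨⟨i₀⟩⟩
  · simp
  have hprob : IsProbabilityMeasure (logGammaMeasure 1 2) := by
    rw [← (hξ i₀).map_eq]; exact Measure.isProbabilityMeasure_map (hξ i₀).aemeasurable
  have htail : ∀ r : ℝ, 0 < r → (logGammaMeasure 1 2).real {x | r < |x|} ≤ (1 / r) ^ (2 : ℝ) := by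
    intro r hr
    rcases le_or_gt 1 r with h | h
    · exact (logGammaMeasure_one_two_tail h).le
    · exact measureReal_le_one.trans
        (Real.one_le_rpow ((one_le_div hr).2 h.le) zero_le_two)
  set b : ι → ℝ := fun i => vecLpNorm 2 fun j => a i j * y j with hb
  have hb0 : ∀ i, 0 ≤ b i := fun i => vecLpNorm_nonneg _
  calc ∫⁻ ω, ENNReal.ofReal (⨆ k : ι × κ, |a k.1 k.2 * y k.2 * ξ k.1 ω|) ∂P₁
      ≤ ∫⁻ ω, ENNReal.ofReal (⨆ i, b i * |ξ i ω|) ∂P₁ := by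
        refine lintegral_mono fun ω => ENNReal.ofReal_le_ofReal (Real.iSup_le (fun k => ?_)
          (Real.iSup_nonneg fun i => mul_nonneg (hb0 i) (abs_nonneg _)))
        rw [abs_mul]
        refine le_trans ?_ (le_ciSup (f := fun i => b i * |ξ i ω|)
          (Set.finite_range _).bddAbove k.1)
        exact mul_le_mul_of_nonneg_right
          (abs_le_vecLpNorm two_pos (fun j => a k.1 j * y j) k.2) (abs_nonneg _)
    _ ≤ ENNReal.ofReal (vecLpNorm 2 b * (2 / (2 - 1))) :=
        lintegral_iSup_le_of_tail_le hξ one_lt_two htail b hb0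
    _ = _ := by
        rw [hb, vecLpNorm_two_rows_eq_columns, mul_comm, ENNReal.ofReal_mul (by norm_num)]
        norm_num

/-- The expected maximum over `Ω₁` dominates the largest rescaled column norm. -/
lemma le_lintegral_iSup_mul (hξ : ∀ i, HasLaw (ξ i) (logGammaMeasure 1 2) P₁)
    (hind : iIndepFun ξ P₁) (a : ι → κ → ℝ) (y : κ → ℝ) :
    ENNReal.ofReal (1 - Real.exp (-1)) *
        ENNReal.ofReal (⨆ j, vecLpNorm 2 (fun i => a i j) * |y j|)
      ≤ ∫⁻ ω, ENNReal.ofReal (⨆ k : ι × κ, |a k.1 k.2 * y k.2 * ξ k.1 ω|) ∂P₁ := by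
  rcases isEmpty_or_nonempty κ with hκ | hκ
  · simp
  -- A column of largest weighted norm; restricting the maximum to it loses only a constant.
  obtain ⟨j, hj⟩ := exists_eq_ciSup_of_finite (f := fun j => vecLpNorm 2 (fun i => a i j) * |y j|)
  have h := le_lintegral_iSup_of_le_tail hξ hind (q := 2) (κ := 1) (τ := 1) (σ := 1) two_pos
    one_pos one_pos (fun r hr => by
      rw [one_mul] at hr ⊢
      exact (logGammaMeasure_one_two_tail hr).ge) (fun i => |a i j| * |y j|) fun i => by positivity
  rw [vecLpNorm_mul_right two_pos, Real.one_rpow, div_one, one_mul, mul_one,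
    ENNReal.ofReal_mul (by simp), hj] at h
  refine h.trans (lintegral_mono fun ω => ENNReal.ofReal_le_ofReal (Real.iSup_le (fun i => ?_)
    (Real.iSup_nonneg fun k => abs_nonneg _)))
  rw [← abs_mul, ← abs_mul]
  exact le_ciSup (f := fun k : ι × κ => |a k.1 k.2 * y k.2 * ξ k.1 ω|)
    (Set.finite_range _).bddAbove (i, j)

end mixed

/-! ### Combining both integrations. -/

theorem mainTheorem5 (p : ℝ) (hp1 : 1 < p) (hp2 : p < 2) :
    ∃ c C : ℝ, 0 < c ∧ 0 < C ∧
      ∀ (Ω₁ : Type*) (Ω₂ : Type*) [MeasurableSpace Ω₁] [MeasurableSpace Ω₂]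
        (P₁ : Measure Ω₁) (P₂ : Measure Ω₂) [IsProbabilityMeasure P₁] [IsProbabilityMeasure P₂]
        (n m : ℕ) (ξ : Fin n → Ω₁ → ℝ) (η : Fin m → Ω₂ → ℝ)
        (σ β : ℝ) (μ : Measure ℝ),
        (∀ i, HasLaw (ξ i) (logGammaMeasure 1 2) P₁) → iIndepFun ξ P₁ →
        IsStableLaw p σ β μ → (∀ j, HasLaw (η j) μ P₂) → iIndepFun η P₂ →
        ∀ a : Fin n → Fin m → ℝ,
          Integrable (fun ω : Ω₁ × Ω₂ =>
              ⨆ k : Fin n × Fin m, |a k.1 k.2 * η k.2 ω.2 * ξ k.1 ω.1|) (P₁.prod P₂) ∧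
          c * σ * vecLpNorm p (fun j => vecLpNorm 2 (fun i => a i j)) ≤
            ∫ ω₁, ∫ ω₂, (⨆ k : Fin n × Fin m, |a k.1 k.2 * η k.2 ω₂ * ξ k.1 ω₁|) ∂P₂ ∂P₁ ∧
          ∫ ω₁, ∫ ω₂, (⨆ k : Fin n × Fin m, |a k.1 k.2 * η k.2 ω₂ * ξ k.1 ω₁|) ∂P₂ ∂P₁ ≤
            C * σ * vecLpNorm p (fun j => vecLpNorm 2 (fun i => a i j)) := by
  have hp0 : 0 < p := by linarith
  have hp1' : 0 < p - 1 := by linarith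
  have hp2' : 0 < 2 - p := by linarith
  have hK := stableTailConst_pos p
  have hδ := stableThreshold_pos hp2
  set K := stableTailConst p
  set δ := stableThreshold p
  have hS : 0 < squareFunctionConst p K := by unfold squareFunctionConst; positivity
  have hc₁ : 0 < 1 - Real.exp (-1) := by simp
  have hc₂ : 0 < 1 - Real.exp (-(δ ^ p / 8 / δ ^ p)) := by
    rw [sub_pos, Real.exp_lt_one_iff, neg_lt_zero]
    positivity
  refine ⟨(1 - Real.exp (-1)) * (δ * (1 - Real.exp (-(δ ^ p / 8 / δ ^ p)))),
    2 * (squareFunctionConst p K * (p / (p - 1))), by positivity, by positivity, ?_⟩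
  intro Ω₁ Ω₂ _ _ P₁ P₂ _ _ n m ξ η σ β μ hξ hξi hμ hη hηi a
  have hσ := hμ.scale_pos
  set A : Fin m → ℝ := fun j => vecLpNorm 2 fun i => a i j
  have hA : ∀ j, 0 ≤ A j := fun j => vecLpNorm_nonneg _
  have hB : 0 ≤ vecLpNorm p A := vecLpNorm_nonneg _
  set T : Ω₁ × Ω₂ → ℝ := fun ω => ⨆ k : Fin n × Fin m, |a k.1 k.2 * η k.2 ω.2 * ξ k.1 ω.1|
    with hT
  have hT0 : ∀ ω, 0 ≤ T ω := fun ω => Real.iSup_nonneg fun k => abs_nonneg _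
  have hTm : AEMeasurable T (P₁.prod P₂) := aemeasurable_iSup_prod hξ hη a
  have hfub := lintegral_prod_symm (μ := P₁) (ν := P₂) (fun ω => ENNReal.ofReal (T ω))
    hTm.ennreal_ofReal
  have hupper : ∫⁻ ω, ENNReal.ofReal (T ω) ∂(P₁.prod P₂) ≤ ENNReal.ofReal
      (2 * (squareFunctionConst p K * (p / (p - 1))) * σ * vecLpNorm p A) := by
    rw [hfub]
    refine (lintegral_mono fun ω₂ => lintegral_iSup_mul_le hξ a fun j => η j ω₂).trans ?_
    rw [lintegral_const_mul' _ _ (by simp)]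
    refine (mul_le_mul_right (lintegral_vecLpNorm_two_le_of_tail_le hη hp1 hp2 hK.le hσ
      (fun r hr => hμ.tail_le hp0.le hr) A hA) 2).trans_eq ?_
    rw [← ENNReal.ofReal_ofNat 2, ← ENNReal.ofReal_mul zero_le_two]
    congr 1
    ring
  have hlower : ENNReal.ofReal ((1 - Real.exp (-1)) *
      (δ * (1 - Real.exp (-(δ ^ p / 8 / δ ^ p)))) * σ * vecLpNorm p A)
        ≤ ∫⁻ ω, ENNReal.ofReal (T ω) ∂(P₁.prod P₂) := by
    rw [hfub]
    refine le_trans ?_ (lintegral_mono fun ω₂ => le_lintegral_iSup_mul hξ hξi a fun j => η j ω₂)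
    rw [lintegral_const_mul' _ _ ENNReal.ofReal_ne_top]
    refine le_trans (le_of_eq ?_) (mul_le_mul_right (le_lintegral_iSup_of_le_tail hη hηi hp0 hδ hσ
      (fun r hr => hμ.le_tail hp0.le hp2 hr) A hA) _)
    rw [← ENNReal.ofReal_mul hc₁.le]
    congr 1
    ring
  -- The upper bound, proved for the lower integral, already gives integrability; only then may the
  -- Bochner integrals be iterated in the stated order.
  have hint : Integrable T (P₁.prod P₂) := by
    refine ⟨hTm.aestronglyMeasurable, ?_⟩
    rw [hasFiniteIntegral_iff_ofReal (ae_of_all _ hT0)]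
    exact hupper.trans_lt ENNReal.ofReal_lt_top
  have hiter : ∫ ω₁, ∫ ω₂, (⨆ k : Fin n × Fin m, |a k.1 k.2 * η k.2 ω₂ * ξ k.1 ω₁|) ∂P₂ ∂P₁
      = ∫ ω, T ω ∂(P₁.prod P₂) := (integral_prod T hint).symm
  rw [← ofReal_integral_eq_lintegral_ofReal hint (ae_of_all _ hT0)] at hupper hlower
  refine ⟨hint, ?_, ?_⟩
  · rw [hiter]
    exact (ENNReal.ofReal_le_ofReal_iff (integral_nonneg hT0)).1 hlower
  · rw [hiter]
    exact (ENNReal.ofReal_le_ofReal_iff (by positivity)).1 hupper
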